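/- Let $D$ be a noncommutative division ring of characteristic different from $2$, and let $n > 2$ be an integer. Let $f, g \colon D \to D$ be additive maps such that $f(x) = x^n g(x^{-1})$ for all $x \in D^{\times}$, where $D^{\times} = D \setminus \{0\}$ is the group of units of $D$. Then $f = -g$, that is, $f(x) = -g(x)$ for all $x \in D$. -/

import Mathlib

/-!
Put `h = f + g`; then `h x = x ^ n * h x⁻¹`. Because `(1 + x⁻¹)⁻¹ = 1 - (x + 1)⁻¹`, such an `h` is
determined by `h 1`, so it suffices to exclude `h 1 ≠ 0`, which may be normalised to `h 1 = 1`.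
Then `h` commutes with every automorphism, in particular with conjugations, so `h x` commutes with
`x`, and Brešar's theorem on commuting maps gives `h x = l * x + μ x` with `l` and `μ x` central.
Invariance under conjugation makes `μ` vanish on commutators.

If `l ≠ 0`, a nonzero commutator `c` thus satisfies `c ^ (2 - n) = 1 + r * c` with `r` central.
Comparing a noncentral `c` with its central multiples `z * c`, which are again commutators, forces
`z ^ (2 - n) = 1` for all central `z ≠ 0`. So the center is finite and all commutators are algebraic
over it, and a theorem of Herstein makes `D` commutative. If `l = 0`, then `h` is central-valued,
hence so is `x ↦ x ^ n`, which is impossible in a noncommutative division ring unless `n = 0`.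
For `n = 0`, expanding `h (x ^ 2)` and `h ((x + 1) ^ 2)` gives `h x = -1` for every noncentral `x`,
contradicting additivity.
-/

open Polynomial

theorem mem_center_of_mul_mem {D : Type*} [DivisionRing D] {z x : D}
    (hz : z ∈ Subring.center D) (hz0 : z ≠ 0) (h : z * x ∈ Subring.center D) :
    x ∈ Subring.center D := by
  rw [← inv_mul_cancel_left₀ hz0 x]
  exact mul_mem (Set.inv_mem_center hz) h

theorem exists_lie_notMem_center {D : Type*} [DivisionRing D] (hnc : ∃ a b : D, a * b ≠ b * a) :
    ∃ x y : D, ⁅x, y⁆ ∉ Subring.center D := by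
  obtain ⟨a, b, hab⟩ := hnc
  by_contra! hc
  have hlie : ⁅a, a * b⁆ = ⁅a, b⁆ * a := by
    rw [← Subring.mem_center_iff.mp (hc a b), Ring.lie_def, Ring.lie_def, mul_sub, mul_assoc a b]
  have ha := mem_center_of_mul_mem (hc a b) (sub_ne_zero.mpr hab) (hlie ▸ hc a (a * b))
  exact hab (Subring.mem_center_iff.mp ha b).symm

/-! ### Biderivations and commuting maps -/

theorem lie_mul_mul_biderivation {R : Type*} [Ring R] {B : R → R → R}
    (hl : ∀ x u w, B (x * u) w = x * B u w + B x w * u)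
    (hr : ∀ w y v, B w (y * v) = y * B w v + B w y * v) (x y z u v : R) :
    ⁅x, y⁆ * z * B u v = B x y * z * ⁅u, v⁆ := by
  have key (x y u v : R) : ⁅x, y⁆ * B u v = B x y * ⁅u, v⁆ := by
    have expand_left : B (x * u) (y * v) =
        x * (y * B u v + B u y * v) + (y * B x v + B x y * v) * u := by rw [hl, hr, hr]
    have expand_right : B (x * u) (y * v) =
        y * (x * B u v + B x v * u) + (x * B u y + B x y * u) * v := by rw [hr, hl, hl]
    rw [← sub_eq_zero, ← sub_eq_zero.mpr (expand_left.symm.trans expand_right), Ring.lie_def,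
      Ring.lie_def]
    noncomm_ring
  have e := key x y (z * u) v
  rw [hl, mul_add, ← mul_assoc _ (B z v), key x y z v, ← mul_assoc] at e
  rw [eq_sub_of_add_eq e, Ring.lie_def, Ring.lie_def, Ring.lie_def]
  noncomm_ring

theorem exists_central_biderivation_eq_mul_lie {D : Type*} [DivisionRing D]
    (hnc : ∃ a b : D, a * b ≠ b * a) {B : D → D → D}
    (hl : ∀ x u w, B (x * u) w = x * B u w + B x w * u)
    (hr : ∀ w y v, B w (y * v) = y * B w v + B w y * v) :
    ∃ l ∈ Subring.center D, ∀ x y, B x y = l * ⁅x, y⁆ := by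
  obtain ⟨a, b, hab⟩ := hnc
  have hc : ⁅a, b⁆ ≠ 0 := sub_ne_zero.mpr hab
  have key := lie_mul_mul_biderivation hl hr
  have hB (x y : D) : B x y = ⁅a, b⁆⁻¹ * B a b * ⁅x, y⁆ := by
    have e := key a b 1 x y
    rw [mul_one, mul_one] at e
    rw [mul_assoc, ← e, inv_mul_cancel_left₀ hc]
  refine ⟨⁅a, b⁆⁻¹ * B a b, Subring.mem_center_iff.mpr fun z => ?_, hB⟩
  refine mul_left_cancel₀ hc (mul_right_cancel₀ hc ?_)
  calc ⁅a, b⁆ * (z * (⁅a, b⁆⁻¹ * B a b)) * ⁅a, b⁆ = ⁅a, b⁆ * z * B a b := by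
        rw [mul_assoc, mul_assoc z, ← hB a b, ← mul_assoc]
    _ = ⁅a, b⁆ * (⁅a, b⁆⁻¹ * B a b * z) * ⁅a, b⁆ := by
        rw [key, mul_assoc ⁅a, b⁆⁻¹, mul_inv_cancel_left₀ hc]

theorem exists_sub_mul_mem_center_of_commute {D : Type*} [DivisionRing D]
    (hnc : ∃ a b : D, a * b ≠ b * a) {h : D →+ D} (hh : ∀ x, Commute (h x) x) :
    ∃ l ∈ Subring.center D, ∀ x, h x - l * x ∈ Subring.center D := by
  have polarized (x y : D) : ⁅h x, y⁆ = ⁅x, h y⁆ := by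
    have e := (hh (x + y)).eq
    simp only [map_add, add_mul, mul_add, (hh x).eq, (hh y).eq] at e
    rw [← sub_eq_zero, ← sub_eq_zero.mpr e, Ring.lie_def, Ring.lie_def]
    abel
  obtain ⟨l, hl, hB⟩ := exists_central_biderivation_eq_mul_lie hnc (B := fun x y => ⁅h x, y⁆)
    (fun x u w => by simp only [polarized, Ring.lie_def]; noncomm_ring)
    (fun w y v => by simp only [Ring.lie_def]; noncomm_ring)
  refine ⟨l, hl, fun x => Subring.mem_center_iff.mpr fun y => ?_⟩
  have hly := Subring.mem_center_iff.mp hl y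
  have e := hB x y
  simp only [Ring.lie_def] at e
  rw [eq_comm, ← sub_eq_zero, sub_mul, mul_sub, ← mul_assoc y, hly, ← sub_eq_zero.mpr e]
  noncomm_ring

/-! ### Commutativity of division rings satisfying algebraic conditions -/

theorem exists_hasEigenvalue_of_aeval_prod_apply_eq_zero {R M : Type*} [CommRing R]
    [AddCommGroup M] [Module R M] {f : Module.End R M} {s : Finset R} {w : M} (hw : w ≠ 0)
    (h : aeval f (∏ c ∈ s, (X - C c)) w = 0) : ∃ c ∈ s, f.HasEigenvalue c := by
  by_contra! hs
  have hinj : Function.Injective (aeval f (∏ c ∈ s, (X - C c))) := by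
    refine Finset.prod_induction _ (fun P => Function.Injective (aeval f P))
      (fun P Q hP hQ => by rw [map_mul]; exact hP.comp hQ)
      (by rw [map_one]; exact Function.injective_id) fun c hc => ?_
    rw [map_sub, aeval_X, aeval_C, ← LinearMap.ker_eq_bot, Algebra.algebraMap_eq_smul_one,
      ← Module.End.eigenspace_def]
    exact not_ne_iff.mp (hs c hc)
  exact hw (hinj (h.trans (map_zero _).symm))

theorem prod_X_sub_C_eq_X_pow_card_sub_X (K : Type*) [Field K] [Fintype K] :
    ∏ c : K, (X - C c) = X ^ Fintype.card K - X := by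
  have hK : 1 < Fintype.card K := Fintype.one_lt_card
  have hmonic : (X ^ Fintype.card K - X : K[X]).Monic :=
    monic_X_pow_sub (by rwa [degree_X, Nat.one_lt_cast])
  have hfactor := prod_multiset_X_sub_C_of_monic_of_roots_card_eq hmonic (by
    rw [FiniteField.roots_X_pow_card_sub_X, FiniteField.X_pow_card_sub_X_natDegree_eq K hK]; rfl)
  rwa [FiniteField.roots_X_pow_card_sub_X] at hfactor

/-- A lemma of Herstein: right multiplication by `i a` is annihilated by `X ^ |K| - X`, a product of
distinct linear factors, and it is not scalar because `i a` is not central. -/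
theorem exists_ne_exists_semiconjBy {K D : Type*} [Field K] [Finite K] [DivisionRing D]
    (i : K →+* D) {a : K} (ha : i a ∉ Subring.center D) :
    ∃ c ≠ a, ∃ y ≠ 0, SemiconjBy y (i a) (i c) := by
  classical
  have := Fintype.ofFinite K
  let _ : Module K D := Module.compHom D i
  let R : Module.End K D :=
    { toFun := fun y => y * i a
      map_add' := fun x y => add_mul x y (i a)
      map_smul' := fun k y => mul_assoc (i k) y (i a) }
  have hR_pow (m : ℕ) (y : D) : (R ^ m) y = y * i a ^ m := by
    induction m generalizing y with
    | zero => simp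
    | succ m ih => rw [pow_succ, Module.End.mul_apply, ih, pow_succ', ← mul_assoc]; rfl
  have hkill (y : D) : aeval R (∏ c : K, (X - C c)) y = 0 := by
    rw [prod_X_sub_C_eq_X_pow_card_sub_X, map_sub, map_pow, aeval_X, LinearMap.sub_apply, hR_pow,
      ← map_pow, FiniteField.pow_card]
    exact sub_self _
  obtain ⟨b, hb⟩ : ∃ b, b * i a ≠ i a * b := by
    by_contra! h
    exact ha (Subring.mem_center_iff.mpr h)
  have hw : aeval R (X - C a) b ≠ 0 := by
    rw [map_sub, aeval_X, aeval_C]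
    exact sub_ne_zero.mpr hb
  have hkill_erase :
      aeval R (∏ c ∈ Finset.univ.erase a, (X - C c)) (aeval R (X - C a) b) = 0 := by
    rw [← Module.End.mul_apply, ← map_mul, Finset.prod_erase_mul _ _ (Finset.mem_univ a), hkill]
  obtain ⟨c, hc, hRc⟩ := exists_hasEigenvalue_of_aeval_prod_apply_eq_zero hw hkill_erase
  obtain ⟨y, hy⟩ := hRc.exists_hasEigenvector
  exact ⟨c, Finset.ne_of_mem_erase hc, y, hy.2, hy.apply_eq_smul⟩

theorem exists_semiconjBy_of_mem_adjoin {R A : Type*} [CommSemiring R] [Semiring A] [Algebra R A]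
    {s : Set A} {K : Subalgebra R A} {y : A} (h : ∀ a ∈ s, ∃ c ∈ K, SemiconjBy y a c) {k : A}
    (hk : k ∈ Algebra.adjoin R s) : ∃ c ∈ K, SemiconjBy y k c := by
  induction hk using Algebra.adjoin_induction with
  | mem a ha => exact h a ha
  | algebraMap r =>
    exact ⟨algebraMap R A r, K.algebraMap_mem r, (Algebra.commutes r y).symm⟩
  | add p q _ _ hp hq =>
    obtain ⟨p', hp', ep⟩ := hp
    obtain ⟨q', hq', eq⟩ := hq
    exact ⟨p' + q', K.add_mem hp' hq', ep.add_right eq⟩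
  | mul p q _ _ hp hq =>
    obtain ⟨p', hp', ep⟩ := hp
    obtain ⟨q', hq', eq⟩ := hq
    exact ⟨p' * q', K.mul_mem hp' hq', ep.mul_right eq⟩

theorem exists_fg_subalgebra_of_semiconjBy {R A : Type*} [CommRing R] [Ring A] [Algebra R A]
    {K : Subalgebra R A} (hK : K.toSubmodule.FG) {y : A} (hy : IsIntegral R y)
    (hyK : ∀ k ∈ K, ∃ c ∈ K, SemiconjBy y k c) :
    ∃ S : Subalgebra R A, K ≤ S ∧ y ∈ S ∧ S.toSubmodule.FG := by
  let L := Algebra.adjoin R {y}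
  let M : Submodule R A := K.toSubmodule * L.toSubmodule
  have hyL : y ∈ L := Algebra.self_mem_adjoin_singleton R y
  have pow_semiconjBy (j : ℕ) : ∀ k ∈ K, ∃ c ∈ K, SemiconjBy (y ^ j) k c := by
    induction j with
    | zero => exact fun k hk => ⟨k, hk, by rw [pow_zero]; exact SemiconjBy.one_left k⟩
    | succ j ih =>
      intro k hk
      obtain ⟨c, hc, e⟩ := hyK k hk
      obtain ⟨c', hc', e'⟩ := ih c hc
      exact ⟨c', hc', pow_succ y j ▸ e'.mul_left e⟩
  have hLK : L.toSubmodule * K.toSubmodule ≤ M := by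
    rw [Submodule.mul_le]
    intro m hm k hk
    obtain ⟨P, rfl⟩ : m ∈ (aeval y : R[X] →ₐ[R] A).range :=
      Algebra.adjoin_singleton_eq_range_aeval R y ▸ hm
    change aeval y P * k ∈ M
    rw [aeval_eq_sum_range, Finset.sum_mul]
    refine M.sum_mem fun j _ => ?_
    obtain ⟨c, hc, e⟩ := pow_semiconjBy j k hk
    rw [smul_mul_assoc, e.eq]
    exact M.smul_mem _ (Submodule.mul_mem_mul hc (L.pow_mem hyL j))
  have hMM : M * M ≤ M := calc
    M * M = K.toSubmodule * (L.toSubmodule * K.toSubmodule) * L.toSubmodule := by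
      simp only [M, mul_assoc]
    _ ≤ K.toSubmodule * M * L.toSubmodule := by gcongr
    _ = M := by rw [← mul_assoc, K.isIdempotentElem_toSubmodule.eq, mul_assoc,
        L.isIdempotentElem_toSubmodule.eq]
  have hKM (k : A) (hk : k ∈ K) : k ∈ M := mul_one k ▸ Submodule.mul_mem_mul hk L.one_mem
  exact ⟨M.toSubalgebra (hKM 1 K.one_mem) fun a b ha hb => hMM (Submodule.mul_mem_mul ha hb), hKM,
    one_mul y ▸ Submodule.mul_mem_mul K.one_mem hyL, hK.mul hy.fg_adjoin_singleton⟩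

/-- Herstein's strengthening of Jacobson's theorem on algebraic algebras over finite fields. -/
theorem mul_comm_of_finite_of_isIntegral_lie {F D : Type*} [Field F] [Finite F] [DivisionRing D]
    [Algebra F D] (hlie : ∀ x y : D, IsIntegral F ⁅x, y⁆) (x y : D) : x * y = y * x := by
  have finite_of_fg {S : Subalgebra F D} (hS : S.toSubmodule.FG) : Finite S :=
    have : Module.Finite F S := Module.Finite.iff_fg.mpr hS
    Module.finite_of_finite F
  by_contra hxy
  obtain ⟨u, v, ha⟩ := exists_lie_notMem_center ⟨x, y, hxy⟩
  set a := ⁅u, v⁆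
  let K := Algebra.adjoin F {a}
  have hK : K.toSubmodule.FG := (hlie u v).fg_adjoin_singleton
  have := finite_of_fg hK
  let _ : Field K := (Finite.isDomain_to_isField K).toField
  let a' : K := ⟨a, Algebra.self_mem_adjoin_singleton F a⟩
  obtain ⟨c, hca, t, ht, htc⟩ :=
    exists_ne_exists_semiconjBy (K.val : K →+* D) (a := a') ha
  replace htc : SemiconjBy t a (c : D) := htc
  have hca' : (c : D) - a ≠ 0 := sub_ne_zero.mpr fun h => hca (Subtype.ext h)
  -- `⁅t, a⁆` conjugates `a` to `c` as well, and it is a commutator, hence algebraic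
  have hs : ⁅t, a⁆ = (c - a) * t := by rw [Ring.lie_def, htc.eq, sub_mul]
  have hsc : SemiconjBy ⁅t, a⁆ a (c : D) := by
    have hcomm : Commute a (c : D) := congrArg Subtype.val (mul_comm a' c)
    exact hs ▸ ((Commute.refl (c : D)).sub_left hcomm).semiconjBy.mul_left htc
  obtain ⟨S, hKS, hsS, hS⟩ := exists_fg_subalgebra_of_semiconjBy hK (hlie t a) fun k hk =>
    exists_semiconjBy_of_mem_adjoin (by simpa using ⟨c, c.2, hsc⟩) hk
  have := finite_of_fg hS
  have hcomm : a * ⁅t, a⁆ = ⁅t, a⁆ * a := congrArg Subtype.val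
    ((Finite.isDomain_to_isField S).mul_comm ⟨a, hKS a'.2⟩ ⟨_, hsS⟩)
  rw [hsc.eq, ← sub_eq_zero, ← sub_mul] at hcomm
  refine (mul_ne_zero ?_ ?_) hcomm
  · rw [← neg_sub]; exact neg_ne_zero.mpr hca'
  · rw [hs]; exact mul_ne_zero hca' ht

theorem mem_range_algebraMap_of_add_pow_mem_range {F A : Type*} [Field F] [Infinite F] [Ring A]
    [Nontrivial A] [Algebra F A] {x : A} (hx : IsSeparable F x) {n : ℕ} (hn : n ≠ 0)
    (h : ∀ z : F, (x + algebraMap F A z) ^ n ∈ (algebraMap F A).range) :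
    x ∈ (algebraMap F A).range := by
  by_contra hxF
  let Ω := AlgebraicClosure F
  have hcard : 1 < Fintype.card ((minpoly F x).rootSet Ω) := by
    rw [card_rootSet_eq_natDegree hx (IsAlgClosed.splits _)]
    exact (minpoly.two_le_natDegree_iff hx.isIntegral).mpr hxF
  obtain ⟨⟨α, hα⟩, ⟨β, hβ⟩, hαβ⟩ := Fintype.exists_pair_of_one_lt_card hcard
  have hroots (z : F) : (α + algebraMap F Ω z) ^ n = (β + algebraMap F Ω z) ^ n := by
    obtain ⟨w, hw⟩ := h z
    have hdvd : minpoly F x ∣ (X + C z) ^ n - C w := minpoly.dvd F x (by simp [hw])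
    have eval_eq {γ : Ω} (hγ : γ ∈ (minpoly F x).rootSet Ω) :
        (γ + algebraMap F Ω z) ^ n = algebraMap F Ω w := by
      have := aeval_eq_zero_of_dvd_aeval_eq_zero hdvd (aeval_eq_zero_of_mem_rootSet hγ)
      simpa [sub_eq_zero] using this
    rw [eval_eq hα, eval_eq hβ]
  have hpoly : (C α + X) ^ n = (C β + X) ^ n :=
    eq_of_infinite_eval_eq _ _ <| (Set.infinite_range_of_injective
      (algebraMap F Ω).injective).mono (by rintro _ ⟨z, rfl⟩; simpa using hroots z)
  have hzero : (0 : Ω) = (β - α) ^ n := by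
    simpa [hn, sub_eq_add_neg] using congrArg (eval (-α)) hpoly
  exact hαβ (Subtype.ext (sub_eq_zero.mp (pow_eq_zero_iff hn |>.mp hzero.symm)).symm)

theorem exists_pow_notMem_center {D : Type*} [DivisionRing D] (hnc : ∃ a b : D, a * b ≠ b * a)
    {n : ℕ} (hn : n ≠ 0) : ∃ x : D, x ^ n ∉ Subring.center D := by
  by_contra! h
  have hint (x : D) : IsIntegral (Subring.center D) x :=
    IsIntegral.of_pow hn.bot_lt (isIntegral_algebraMap (x := (⟨_, h x⟩ : Subring.center D)))
  obtain ⟨a, b, hab⟩ := hnc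
  cases finite_or_infinite (Subring.center D)
  · exact hab (mul_comm_of_finite_of_isIntegral_lie (fun x y => hint ⁅x, y⁆) a b)
  · have : Algebra.IsIntegral (Subring.center D) D := ⟨hint⟩
    obtain ⟨x, hxc, hxs⟩ := JacobsonNoether.exists_separable_and_not_isCentral D fun htop =>
      hab (Subring.mem_center_iff.mp (htop ▸ Subring.mem_top b) a)
    obtain ⟨z, rfl⟩ := mem_range_algebraMap_of_add_pow_mem_range hxs hn fun z =>
      ⟨⟨_, h (x + z)⟩, rfl⟩
    exact hxc z.2

theorem finite_of_zpow_eq_one {F : Type*} [Field F] {m : ℤ} (hm : m ≠ 0)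
    (h : ∀ z : F, z ≠ 0 → z ^ m = 1) : Finite F := by
  have hroot (z : F) : (X * (X ^ m.natAbs - 1) : F[X]).IsRoot z := by
    rcases eq_or_ne z 0 with rfl | hz
    · simp
    · have hpow : z ^ m.natAbs = 1 := by
        rcases Int.natAbs_eq m with e | e
        · rw [← zpow_natCast, ← e, h z hz]
        · rw [← inv_inj, ← zpow_natCast, ← zpow_neg, ← e, h z hz, inv_one]
      simp [hpow]
  by_contra hF
  rw [not_finite_iff_infinite] at hF
  refine mul_ne_zero X_ne_zero (X_pow_sub_C_ne_zero (Int.natAbs_pos.mpr hm) (1 : F)) ?_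
  exact eq_zero_of_infinite_isRoot _ (Set.infinite_univ.mono fun z _ => hroot z)

theorem isIntegral_of_zpow_eq_one_add_smul {F A : Type*} [Field F] [DivisionRing A] [Algebra F A]
    {x : A} {m : ℤ} (hm : m ≠ 0) {r : F} (h : x ^ m = 1 + r • x) : IsIntegral F x := by
  rcases eq_or_ne x 0 with rfl | hx
  · exact isIntegral_zero
  have hm' : m.natAbs ≠ 0 := Int.natAbs_ne_zero.mpr hm
  rw [← isAlgebraic_iff_isIntegral]
  rcases Int.natAbs_eq m with e | e
  · refine ⟨X ^ m.natAbs - (1 + C r * X), fun h0 => ?_, ?_⟩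
    · simpa [hm'.symm] using congrArg (coeff · 0) h0
    · rw [e, zpow_natCast] at h
      simp [h, Algebra.smul_def]
  · refine ⟨1 - X ^ m.natAbs * (1 + C r * X), fun h0 => ?_, ?_⟩
    · simpa [hm'.symm] using congrArg (coeff · 0) h0
    · rw [e, zpow_neg, zpow_natCast] at h
      simp [← Algebra.smul_def, ← h, hx]

theorem zpow_eq_one_of_smul_zpow_eq {F A : Type*} [Field F] [DivisionRing A] [Algebra F A]
    {c : A} (hc : c ∉ (algebraMap F A).range) {m : ℤ} {r s z : F} (h : c ^ m = 1 + r • c)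
    (hz : (z • c) ^ m = 1 + s • z • c) : z ^ m = 1 := by
  have hsmul : (z • c) ^ m = z ^ m • c ^ m := by
    have hcomm : Commute (algebraMap F A z) c := Algebra.commutes z c
    simp only [Algebra.smul_def, hcomm.mul_zpow, map_zpow₀]
  have hlin : (z ^ m * r - s * z) • c = algebraMap F A (1 - z ^ m) := by
    rw [sub_smul, mul_smul, mul_smul, map_sub, map_one, Algebra.algebraMap_eq_smul_one,
      sub_eq_sub_iff_add_eq_add, add_comm, ← smul_add, ← h, ← hsmul, hz]
  have hcoeff : z ^ m * r - s * z = 0 := by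
    by_contra h0
    refine hc ⟨(z ^ m * r - s * z)⁻¹ * (1 - z ^ m), ?_⟩
    rw [map_mul, ← hlin, ← Algebra.smul_def, inv_smul_smul₀ h0]
  rw [hcoeff, zero_smul, eq_comm, map_eq_zero, sub_eq_zero] at hlin
  exact hlin.symm

/-! ### Maps fixed by a twisted inversion -/

/-- An additive map of a division ring that is fixed by the twisted inversion
`h ↦ (x ↦ x ^ n * h x⁻¹)`. This exchanges `f` and `g` when `f x = x ^ n * g x⁻¹`, so it fixes
`f + g`. The condition at `x = 0`, where `x⁻¹ = 0`, is omitted. -/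
def InversionSymmetric {D : Type*} [DivisionRing D] (n : ℤ) (h : D →+ D) : Prop :=
  ∀ x : D, x ≠ 0 → h x = x ^ n * h x⁻¹

namespace InversionSymmetric

variable {D : Type*} [DivisionRing D] {n : ℤ} {h k : D →+ D}

theorem sub (hs : InversionSymmetric n h) (ks : InversionSymmetric n k) :
    InversionSymmetric n (h - k) := fun x hx => by
  rw [AddMonoidHom.sub_apply, AddMonoidHom.sub_apply, hs x hx, ks x hx, mul_sub]

theorem mulRight_comp (hs : InversionSymmetric n h) (d : D) :
    InversionSymmetric n ((AddMonoidHom.mulRight d).comp h) := fun x hx => by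
  simp [hs x hx, mul_assoc]

theorem conj_ringEquiv (hs : InversionSymmetric n h) (φ : D ≃+* D) :
    InversionSymmetric n ((φ.symm : D →+ D).comp (h.comp (φ : D →+ D))) := fun x hx => by
  have e := hs (φ x) ((map_ne_zero φ).mpr hx)
  simp [e, map_inv₀, map_zpow₀]

theorem eq_zero_of_apply_one (hs : InversionSymmetric n h) (h2 : (2 : D) ≠ 0) (h1 : h 1 = 0) :
    h = 0 := by
  ext x
  rw [AddMonoidHom.zero_apply]
  rcases eq_or_ne x 0 with rfl | hx
  · exact map_zero h
  rcases eq_or_ne (x + 1) 0 with hx1 | hx1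
  · rw [eq_neg_of_add_eq_zero_left hx1, map_neg, h1, neg_zero]
  have hfac : 1 + x⁻¹ = x⁻¹ * (x + 1) := by rw [mul_add, inv_mul_cancel₀ hx, mul_one]
  have hinv : (1 + x⁻¹)⁻¹ = 1 - (x + 1)⁻¹ := by
    rw [hfac, mul_inv_rev, inv_inv, eq_sub_iff_add_eq, ← mul_add_one, inv_mul_cancel₀ hx1]
  have hx_eq : h x = (x + 1) ^ n * h (x + 1)⁻¹ := by rw [← hs _ hx1, map_add, h1, add_zero]
  have hx_inv : h x⁻¹ = -((1 + x⁻¹) ^ n * h (x + 1)⁻¹) := by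
    have := hs (1 + x⁻¹) (hfac ▸ mul_ne_zero (inv_ne_zero hx) hx1)
    rwa [hinv, map_sub, h1, zero_sub, map_add, h1, zero_add, mul_neg] at this
  have hcomm : Commute x (1 + x⁻¹) := (Commute.one_right x).add_right (Commute.refl x).inv_right₀
  have hneg : h x = -h x := calc
    h x = -((x * (1 + x⁻¹)) ^ n * h (x + 1)⁻¹) := by
      rw [hs x hx, hx_inv, mul_neg, ← mul_assoc, hcomm.mul_zpow]
    _ = -h x := by rw [hfac, mul_inv_cancel_left₀ hx, ← hx_eq]
  have hdouble : 2 * h x = 0 := by rw [two_mul, ← eq_neg_iff_add_eq_zero, ← hneg]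
  exact (mul_eq_zero.mp hdouble).resolve_left h2

theorem eq_of_apply_one_eq (hs : InversionSymmetric n h) (ks : InversionSymmetric n k)
    (h2 : (2 : D) ≠ 0) (h1 : h 1 = k 1) : h = k :=
  sub_eq_zero.mp ((hs.sub ks).eq_zero_of_apply_one h2 (by simp [h1]))

theorem map_ringEquiv (hs : InversionSymmetric n h) (h2 : (2 : D) ≠ 0) (h1 : h 1 = 1)
    (φ : D ≃+* D) (x : D) : h (φ x) = φ (h x) := by
  have e := DFunLike.congr_fun
    ((hs.conj_ringEquiv φ).eq_of_apply_one_eq hs h2 (by simp [h1])) x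
  exact (φ.symm_apply_eq).mp e

theorem map_conj (hs : InversionSymmetric n h) (h2 : (2 : D) ≠ 0) (h1 : h 1 = 1) {u : D}
    (hu : u ≠ 0) (x : D) : h (u * x * u⁻¹) = u * h x * u⁻¹ :=
  hs.map_ringEquiv h2 h1
    (MulSemiringAction.toRingEquiv (ConjAct Dˣ) D (ConjAct.toConjAct (Units.mk0 u hu))) x

theorem commute_apply (hs : InversionSymmetric n h) (h2 : (2 : D) ≠ 0) (h1 : h 1 = 1) (x : D) :
    Commute (h x) x := by
  rcases eq_or_ne x 0 with rfl | hx
  · exact Commute.zero_right _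
  · have e := hs.map_conj h2 h1 hx x
    rw [mul_inv_cancel_right₀ hx] at e
    exact (eq_mul_inv_iff_mul_eq₀ hx).mp e

theorem apply_lie (hs : InversionSymmetric n h) (h2 : (2 : D) ≠ 0) (h1 : h 1 = 1)
    {l : D} (hl : l ∈ Subring.center D) (hh : ∀ x, h x - l * x ∈ Subring.center D) (x y : D) :
    h ⁅x, y⁆ = l * ⁅x, y⁆ := by
  rw [Ring.lie_def, map_sub, mul_sub, sub_eq_sub_iff_sub_eq_sub]
  rcases eq_or_ne x 0 with rfl | hx
  · simp only [zero_mul, mul_zero]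
  have hconj : x * y = x * (y * x) * x⁻¹ := by rw [← mul_assoc, mul_inv_cancel_right₀ hx]
  calc
    h (x * y) - l * (x * y) = x * (h (y * x) - l * (y * x)) * x⁻¹ := by
      rw [hconj, hs.map_conj h2 h1 hx, mul_sub, sub_mul, ← mul_assoc x l,
        Subring.mem_center_iff.mp hl x, mul_assoc l, mul_assoc l]
    _ = h (y * x) - l * (y * x) := by
      rw [Subring.mem_center_iff.mp (hh (y * x)) x, mul_inv_cancel_right₀ hx]

theorem exists_zpow_two_sub_eq_one_add_smul (hs : InversionSymmetric n h) {l x : D}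
    (hl : l ∈ Subring.center D) (hl0 : l ≠ 0) (hh : h x⁻¹ - l * x⁻¹ ∈ Subring.center D)
    (hx0 : x ≠ 0) (hx : h x = l * x) :
    ∃ r : Subring.center D, x ^ (2 - n) = 1 + r • x := by
  refine ⟨⟨l⁻¹ * (h x⁻¹ - l * x⁻¹), mul_mem (Set.inv_mem_center hl) hh⟩, ?_⟩
  have hx_inv : h x⁻¹ = l * x ^ (-n) * x := by
    rw [hs _ (inv_ne_zero hx0), inv_inv, hx, inv_zpow', ← mul_assoc,
      Subring.mem_center_iff.mp hl]
  calc x ^ (2 - n) = x ^ (-n) * x * x := by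
        rw [← zpow_add_one₀ hx0, ← zpow_add_one₀ hx0]; congr 1; ring
    _ = 1 + l⁻¹ * (h x⁻¹ - l * x⁻¹) * x := by
        rw [mul_sub, inv_mul_cancel_left₀ hl0, sub_mul, inv_mul_cancel₀ hx0, add_sub_cancel,
          hx_inv, mul_assoc l, inv_mul_cancel_left₀ hl0]

theorem eq_zero_of_sub_mul_mem_center (hs : InversionSymmetric n h)
    (hnc : ∃ a b : D, a * b ≠ b * a) (h2 : (2 : D) ≠ 0) (hn : n ≠ 2) (h1 : h 1 = 1) {l : D}
    (hl : l ∈ Subring.center D) (hh : ∀ x, h x - l * x ∈ Subring.center D) : l = 0 := by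
  by_contra hl0
  have hlie_zpow (x y : D) (hxy : ⁅x, y⁆ ≠ 0) :
      ∃ r : Subring.center D, ⁅x, y⁆ ^ (2 - n) = 1 + r • ⁅x, y⁆ :=
    hs.exists_zpow_two_sub_eq_one_add_smul hl hl0 (hh _) hxy (hs.apply_lie h2 h1 hl hh x y)
  have hn' : 2 - n ≠ 0 := sub_ne_zero.mpr hn.symm
  have : Finite (Subring.center D) := by
    obtain ⟨x, y, hxy⟩ := exists_lie_notMem_center hnc
    have hxy0 : ⁅x, y⁆ ≠ 0 := fun h0 => hxy (h0 ▸ zero_mem _)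
    refine finite_of_zpow_eq_one hn' fun z hz => ?_
    obtain ⟨r, hr⟩ := hlie_zpow x y hxy0
    have hsmul : ⁅z • x, y⁆ = z • ⁅x, y⁆ := by
      simp only [Ring.lie_def, smul_mul_assoc, mul_smul_comm, smul_sub]
    obtain ⟨s, hsz⟩ := hlie_zpow (z • x) y (hsmul ▸ smul_ne_zero hz hxy0)
    rw [hsmul] at hsz
    exact zpow_eq_one_of_smul_zpow_eq (by rintro ⟨w, hw⟩; exact hxy (hw ▸ w.2)) hr hsz
  obtain ⟨a, b, hab⟩ := hnc
  refine hab (mul_comm_of_finite_of_isIntegral_lie (F := Subring.center D) (fun x y => ?_) a b)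
  rcases eq_or_ne ⁅x, y⁆ 0 with hxy | hxy
  · exact hxy ▸ isIntegral_zero
  · obtain ⟨r, hr⟩ := hlie_zpow x y hxy
    exact isIntegral_of_zpow_eq_one_add_smul hn' hr

theorem apply_sq (hs : InversionSymmetric n h) (h1 : h 1 = 1) {x : D} (hx : x ≠ 0)
    (hx1 : x + 1 ≠ 0) : h (x ^ 2) = ((x + 1) ^ n - x ^ n - 1) * h x - x ^ n := by
  have hcomm : Commute x (x + 1) := (Commute.refl x).add_right (Commute.one_right x)
  have hinv : (x * (x + 1))⁻¹ = x⁻¹ - (x + 1)⁻¹ := by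
    rw [hcomm.inv_sub_inv hx hx1, add_sub_cancel_left, one_div]
  have hprod : h (x * (x + 1)) = (x + 1) ^ n * h x - x ^ n * (h x + 1) := calc
    h (x * (x + 1)) = (x * (x + 1)) ^ n * (h x⁻¹ - h (x + 1)⁻¹) := by
      rw [hs _ (mul_ne_zero hx hx1), hinv, map_sub]
    _ = (x + 1) ^ n * (x ^ n * h x⁻¹) - x ^ n * ((x + 1) ^ n * h (x + 1)⁻¹) := by
      rw [hcomm.mul_zpow, mul_sub, mul_assoc (x ^ n) _ (h (x + 1)⁻¹),
        ((hcomm.zpow_left₀ n).zpow_right₀ n).eq, mul_assoc]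
    _ = (x + 1) ^ n * h x - x ^ n * (h x + 1) := by
      rw [← hs x hx, ← hs _ hx1, map_add, h1]
  have hsq : x ^ 2 = x * (x + 1) - x := by noncomm_ring
  rw [hsq, map_sub, hprod]
  noncomm_ring

theorem ne_zero (hs : InversionSymmetric n h) (hnc : ∃ a b : D, a * b ≠ b * a) (h2 : (2 : D) ≠ 0)
    (h1 : h 1 = 1) : n ≠ 0 := by
  rintro rfl
  obtain ⟨a, b, hab⟩ := hnc
  have ha (m : ℕ) : a + m ≠ 0 := fun hm => by
    rw [eq_neg_of_add_eq_zero_left hm] at hab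
    exact hab (m.cast_commute b).neg_left.eq
  have apply_eq_neg_one {x : D} (hx : ∀ m : ℕ, x + m ≠ 0) : h x = -1 := by
    have hx0 : x ≠ 0 := by simpa using hx 0
    have hx1 : x + 1 ≠ 0 := by simpa using hx 1
    have hx2 : x + 1 + 1 ≠ 0 := by simpa [add_assoc, one_add_one_eq_two] using hx 2
    have hsq : h (x ^ 2) = -h x - 1 := by simpa using hs.apply_sq h1 hx0 hx1
    have hsq1 : h ((x + 1) ^ 2) = -h (x + 1) - 1 := by simpa using hs.apply_sq h1 hx1 hx2
    have hexp : (x + 1) ^ 2 = x ^ 2 + x + x + 1 := by noncomm_ring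
    simp only [hexp, map_add, hsq, h1] at hsq1
    have hdouble : 2 * (h x + 1) = 0 := by
      rw [← sub_eq_zero.mpr hsq1]
      noncomm_ring
    exact eq_neg_of_add_eq_zero_left ((mul_eq_zero.mp hdouble).resolve_left h2)
  have ha1 : h (a + 1) = -1 :=
    apply_eq_neg_one fun m => by rw [add_assoc, add_comm 1]; exact_mod_cast ha (m + 1)
  rw [map_add, apply_eq_neg_one ha, h1, neg_add_cancel, eq_comm, neg_eq_zero] at ha1
  exact one_ne_zero ha1

theorem zpow_mem_center (hs : InversionSymmetric n h) (h1 : h 1 = 1) (hn : n ≠ 0)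
    (hh : ∀ x, h x ∈ Subring.center D) (x : D) : x ^ n ∈ Subring.center D := by
  rcases eq_or_ne x 0 with rfl | hx
  · rw [zero_zpow n hn]; exact zero_mem _
  by_cases hx0 : h x = 0
  · have hx1 : x + 1 ≠ 0 := fun hx1 => by
      simp [eq_neg_of_add_eq_zero_left hx1, h1] at hx0
    have e : h (x ^ 2) = -x ^ n := by simpa [hx0] using hs.apply_sq h1 hx hx1
    exact neg_mem_iff.mp (e ▸ hh (x ^ 2))
  · have e := hs x hx
    have hx_inv : h x⁻¹ ≠ 0 := fun h0 => hx0 (by rw [e, h0, mul_zero])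
    rw [(eq_mul_inv_iff_mul_eq₀ hx_inv).mpr e.symm]
    exact mul_mem (hh x) (Set.inv_mem_center (hh x⁻¹))

theorem apply_one_ne_one (hs : InversionSymmetric n h) (hnc : ∃ a b : D, a * b ≠ b * a)
    (h2 : (2 : D) ≠ 0) (hn : n ≠ 2) : h 1 ≠ 1 := by
  intro h1
  obtain ⟨l, hl, hh⟩ := exists_sub_mul_mem_center_of_commute hnc (hs.commute_apply h2 h1)
  obtain rfl := hs.eq_zero_of_sub_mul_mem_center hnc h2 hn h1 hl hh
  have hn0 := hs.ne_zero hnc h2 h1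
  obtain ⟨x, hx⟩ := exists_pow_notMem_center hnc (Int.natAbs_ne_zero.mpr hn0)
  have hxn := hs.zpow_mem_center h1 hn0 (fun x => by simpa using hh x) x
  rcases Int.natAbs_eq n with e | e
  · rw [e, zpow_natCast] at hxn
    exact hx hxn
  · rw [e, zpow_neg, zpow_natCast] at hxn
    exact hx (inv_inv (x ^ n.natAbs) ▸ Set.inv_mem_center hxn)

end InversionSymmetric

theorem proposition5p6_general {D : Type*} [DivisionRing D]
    (hnc : ∃ a b : D, a * b ≠ b * a) (hchar : ringChar D ≠ 2)
    (n : ℤ) (hn : n ≠ 2) (f g : D →+ D)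
    (hfg : ∀ x : Dˣ, f (x : D) = (x : D) ^ n * g ((x⁻¹ : Dˣ) : D)) :
    f = -g := by
  have h2 : (2 : D) ≠ 0 := Ring.two_ne_zero hchar
  have hfg' (x : D) (hx : x ≠ 0) : f x = x ^ n * g x⁻¹ := by simpa using hfg (Units.mk0 x hx)
  have hs : InversionSymmetric n (f + g) := fun x hx => by
    have e := hfg' _ (inv_ne_zero hx)
    rw [inv_inv, inv_zpow] at e
    rw [AddMonoidHom.add_apply, AddMonoidHom.add_apply, mul_add, ← hfg' x hx, e,
      mul_inv_cancel_left₀ (zpow_ne_zero n hx), add_comm]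
  have hone : (f + g) 1 = 0 := by
    by_contra hc
    exact (hs.mulRight_comp ((f + g) 1)⁻¹).apply_one_ne_one hnc h2 hn (mul_inv_cancel₀ hc)
  exact eq_neg_of_add_eq_zero_left (hs.eq_zero_of_apply_one h2 hone)

theorem proposition5p6 {D : Type*} [DivisionRing D]
    (hnc : ∃ a b : D, a * b ≠ b * a) (hchar : ringChar D ≠ 2)
    (n : ℕ) (hn : 2 < n) (f g : D →+ D)
    (hfg : ∀ x : Dˣ, f (x : D) = (x : D) ^ n * g ((x⁻¹ : Dˣ) : D)) :
    f = -g :=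
  proposition5p6_general hnc hchar n (by omega) f g (by simpa using hfg)
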